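/- Let $H$ be a separable infinite-dimensional complex Hilbert space with an orthonormal basis $(e_n)_{n\in\mathbb N}$, let $B(H)$ be the bounded operators on $H$, and write $a_{mk}=\langle a e_k,e_m\rangle$ for $a\in B(H)$. For a permutation $\rho$ of $\mathbb N$ let $\pi(\rho)\in B(H)$ be the unitary with $\pi(\rho)e_n=e_{\rho(n)}$ for all $n$. Let $\mathrm{FS}_{\mathbb N}$ be the group of the permutations $\rho$ of $\mathbb N$ with $\rho(n)=n$ for all but finitely many $n$, and let \[\mathrm{DSS}=\Big\{a\in B(H)\ \Big|\ a_{mk}\ge 0,\ \sum_{k}a_{mk}\le 1,\ \sum_{k}a_{km}\le 1\ \text{ for all } m,k\Big\},\] \[\mathrm{PS}_{\mathbb N}=\Big\{a\in B(H)\ \Big|\ a_{mk}\in\{0,1\},\ \sum_{k}a_{mk}\le 1,\ \sum_{k}a_{km}\le 1\ \text{ for all } m,k\Big\}\] be the doubly substochastic operators and the partial permutation matrices. Let $B(H)_*$ be the predual of $B(H)$, that is, the space of the functionals $a\mapsto\sum_n\langle a x_n,y_n\rangle$ with $\sum_n\|x_n\|^2<\infty$ and $\sum_n\|y_n\|^2<\infty$.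 The Arens--Mackey topology on $B(H)$ is the Mackey topology $\tau(B(H),B(H)_*)$, that is, the topology of uniform convergence on the convex balanced $\sigma(B(H)_*,B(H))$-compact subsets of $B(H)_*$; the weak topology is the weak operator topology. Then \[\overline{\mathrm{co}}^{M}\,\pi(\mathrm{FS}_{\mathbb N})=\mathrm{DSS}=\overline{\mathrm{co}}^{w}\,\pi(\mathrm{FS}_{\mathbb N}),\] where $\overline{\mathrm{co}}^{M}$ and $\overline{\mathrm{co}}^{w}$ denote the closures of the convex hull in the Arens--Mackey and in the weak topology, respectively. Moreover, the set of extreme points of $\mathrm{DSS}$ is exactly $\mathrm{PS}_{\mathbb N}$. -/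

import Mathlib

noncomputable section

namespace PermHull

open scoped Topology InnerProductSpace ComplexOrder

/-- The Mackey topology `τ(E, F)` on `E` for a pairing `B` of complex vector spaces `F` and `E`:
uniform convergence on the convex balanced `σ(F, E)`-compact subsets of `F`
(`WeakBilin B` is `F` with the topology `σ(F, E)`). -/
@[reducible]
def mackeyTopology {F E : Type*} [AddCommGroup F] [Module ℂ F] [AddCommGroup E] [Module ℂ E]
    (B : F →ₗ[ℂ] E →ₗ[ℂ] ℂ) : TopologicalSpace E :=
  TopologicalSpace.induced
    (fun e : E =>
      UniformOnFun.ofFun {K : Set (WeakBilin B) | Convex ℝ K ∧ Balanced ℂ K ∧ IsCompact K}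
        (fun f : WeakBilin B => (B f e : ℂ)))
    inferInstance

/-- The predual `B(H)_*`: the functionals `a ↦ ∑ₙ ⟨a xₙ, yₙ⟩` with `∑ₙ ‖xₙ‖² < ∞` and
`∑ₙ ‖yₙ‖² < ∞`. -/
def predual (H : Type*) [NormedAddCommGroup H] [InnerProductSpace ℂ H] :
    Submodule ℂ (Module.Dual ℂ (H →L[ℂ] H)) where
  carrier := {f | ∃ x y : ℕ → H, Summable (fun n => ‖x n‖ ^ 2) ∧ Summable (fun n => ‖y n‖ ^ 2) ∧
    ∀ a : H →L[ℂ] H, HasSum (fun n => ⟪y n, a (x n)⟫_ℂ) (f a)}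
  zero_mem' := ⟨0, 0, by simp [summable_zero], by simp [summable_zero],
    fun a => by simp [hasSum_zero]⟩
  add_mem' := by
    rintro f g ⟨x, y, hx, hy, hf⟩ ⟨x', y', hx', hy', hg⟩
    have key : ∀ {M : Type} [AddCommMonoid M] [TopologicalSpace M] [ContinuousAdd M]
        (u v : ℕ → M) (s t : M), HasSum u s → HasSum v t →
        HasSum (Sum.elim u v ∘ Equiv.natSumNatEquivNat.symm) (s + t) := by
      intro M _ _ _ u v s t hu hv
      rw [Equiv.hasSum_iff]
      exact HasSum.sum (f := Sum.elim u v) hu hv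
    refine ⟨Sum.elim x x' ∘ Equiv.natSumNatEquivNat.symm,
      Sum.elim y y' ∘ Equiv.natSumNatEquivNat.symm, ?_, ?_, fun a => ?_⟩
    · refine (key _ _ _ _ hx.hasSum hx'.hasSum).summable.congr fun n => ?_
      rcases h : Equiv.natSumNatEquivNat.symm n with k | k <;> simp [h]
    · refine (key _ _ _ _ hy.hasSum hy'.hasSum).summable.congr fun n => ?_
      rcases h : Equiv.natSumNatEquivNat.symm n with k | k <;> simp [h]
    · rw [LinearMap.add_apply]
      convert key _ _ _ _ (hf a) (hg a) using 1
      funext n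
      rcases h : Equiv.natSumNatEquivNat.symm n with k | k <;> simp [h]
  smul_mem' := by
    rintro c f ⟨x, y, hx, hy, hf⟩
    refine ⟨fun n => c • x n, y, ?_, hy, fun a => ?_⟩
    · simpa [norm_smul, mul_pow] using hx.mul_left (‖c‖ ^ 2)
    · simpa [inner_smul_right] using (hf a).mul_left c

/-- The Arens–Mackey topology `τ(B(H), B(H)_*)` on `B(H)`. -/
@[reducible]
def arensMackey (H : Type*) [NormedAddCommGroup H] [InnerProductSpace ℂ H] :
    TopologicalSpace (H →L[ℂ] H) :=
  mackeyTopology (predual H).subtype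

/-- The weak operator topology on `B(H)`. -/
@[reducible]
def weakOperator (H : Type*) [NormedAddCommGroup H] [InnerProductSpace ℂ H] :
    TopologicalSpace (H →L[ℂ] H) :=
  TopologicalSpace.induced (fun a => (ContinuousLinearMapWOT.ofCLM a : H →WOT[ℂ] H)) inferInstance

variable {H : Type*} [NormedAddCommGroup H] [InnerProductSpace ℂ H]

/-- The closed convex hull of `s` in `B(H)` for the topology `t`: the `t`-closure of `co(s)`. -/
def closedHull (t : TopologicalSpace (H →L[ℂ] H)) (s : Set (H →L[ℂ] H)) : Set (H →L[ℂ] H) :=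
  closure[t] (convexHull ℝ s)

/-- The matrix coefficient `a_{mk} = ⟨a e_k, e_m⟩`; Mathlib's inner product is linear in the
second argument. -/
def coeff (e : HilbertBasis ℕ ℂ H) (a : H →L[ℂ] H) (m k : ℕ) : ℂ := ⟪e m, a (e k)⟫_ℂ

/-- The doubly substochastic operators. On `ℂ`, `0 ≤ z` says that `z` is real and nonnegative. -/
def DSS (e : HilbertBasis ℕ ℂ H) : Set (H →L[ℂ] H) :=
  {a | (∀ m k, 0 ≤ coeff e a m k) ∧
    (∀ m, Summable (fun k => coeff e a m k) ∧ ∑' k, coeff e a m k ≤ 1) ∧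
    (∀ m, Summable (fun k => coeff e a k m) ∧ ∑' k, coeff e a k m ≤ 1)}

/-- The partial permutation matrices. -/
def PS (e : HilbertBasis ℕ ℂ H) : Set (H →L[ℂ] H) :=
  {a | (∀ m k, coeff e a m k = 0 ∨ coeff e a m k = 1) ∧
    (∀ m, Summable (fun k => coeff e a m k) ∧ ∑' k, coeff e a m k ≤ 1) ∧
    (∀ m, Summable (fun k => coeff e a k m) ∧ ∑' k, coeff e a k m ≤ 1)}

/-- The finitary symmetric group, as a set of permutations of `ℕ`. -/
def FS : Set (Equiv.Perm ℕ) := {ρ | ∀ᶠ n in Filter.atTop, ρ n = n}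

/-- The orthonormal basis `(e_{ρ(n)})ₙ`. -/
def permBasis [CompleteSpace H] (e : HilbertBasis ℕ ℂ H) (ρ : Equiv.Perm ℕ) : HilbertBasis ℕ ℂ H :=
  HilbertBasis.mk (v := fun n => e (ρ n)) (e.orthonormal.comp ρ ρ.injective) (by
    have h : Set.range (fun n => e (ρ n)) = Set.range e := ρ.surjective.range_comp e
    rw [h, e.dense_span])

/-- The operator `π(ρ)`: the unitary that carries the basis `(e_n)` to `(e_{ρ(n)})`. -/
def permOp [CompleteSpace H] (e : HilbertBasis ℕ ℂ H) (ρ : Equiv.Perm ℕ) : H →L[ℂ] H :=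
  ((e.repr.trans (permBasis e ρ).repr.symm).toContinuousLinearEquiv : H →L[ℂ] H)

/-- The defining property `π(ρ) e_n = e_{ρ(n)}`. -/
theorem permOp_apply [CompleteSpace H] (e : HilbertBasis ℕ ℂ H) (ρ : Equiv.Perm ℕ) (n : ℕ) :
    permOp e ρ (e n) = e (ρ n) := by
  have h : (permBasis e ρ) n = e (ρ n) := by
    simp only [permBasis, HilbertBasis.coe_mk]
  rw [← h, ← (permBasis e ρ).repr_symm_single n, ← e.repr_self n]
  rfl

end PermHull

end

/-! The two hulls and `DSS` form a cycle of inclusions. The Mackey topology is finer than the weak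
one, since rank one functionals are Mackey continuous; and `DSS` is convex, weakly closed and
contains the permutation operators. The substance is that `DSS` lies in the Mackey hull. By a
minimax argument, Mackey approximation from a convex set can be tested on one predual functional at
a time (`mem_closure_mackeyTopology`). The N × N corner of a substochastic matrix sits in a doubly
stochastic matrix of size 2N, which Birkhoff's theorem writes as a convex combination of
permutations. This yields contractions whose coefficients converge, so every predual functional
converges along them.

For the extreme points, fix a position. The substochastic matrices with entry 1 there and those with
entry 0 there are compact convex sets; their join is compact, convex and contains every permutation
matrix, hence by density every substochastic matrix. Schur's test turns matrices back into
operators, so an extreme point has entries 0 or 1. Conversely, 0 and 1 are extreme in [0, 1]. -/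

noncomputable section

namespace PermHull

open scoped Topology InnerProductSpace ComplexOrder Pointwise

/-! ### Closures of convex sets in the Mackey topology -/

section Mackey

variable {F E : Type*} [AddCommGroup F] [Module ℂ F] [AddCommGroup E] [Module ℂ E]
  (B : F →ₗ[ℂ] E →ₗ[ℂ] ℂ)

/-- The sets on which the Mackey topology is uniform convergence. -/
def mackeyFamily : Set (Set (WeakBilin B)) :=
  {K | Convex ℝ K ∧ Balanced ℂ K ∧ IsCompact K}

theorem continuousSMul_real_weakBilin : ContinuousSMul ℝ (WeakBilin B) :=
  IsScalarTower.continuousSMul ℂ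

theorem mackeyFamily_nonempty : (mackeyFamily B).Nonempty :=
  ⟨{0}, convex_singleton 0, balanced_zero, isCompact_singleton⟩

theorem mackeyFamily_directedOn : DirectedOn (· ⊆ ·) (mackeyFamily B) := by
  rintro K ⟨h1, h2, h3⟩ L ⟨h1', h2', h3'⟩
  -- The sum `K + L` contains both sets only because a nonempty balanced set contains 0, so the
  -- empty set is treated apart.
  rcases K.eq_empty_or_nonempty with rfl | hK
  · exact ⟨L, ⟨h1', h2', h3'⟩, Set.empty_subset _, subset_rfl⟩
  rcases L.eq_empty_or_nonempty with rfl | hL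
  · exact ⟨K, ⟨h1, h2, h3⟩, subset_rfl, Set.empty_subset _⟩
  refine ⟨K + L, ⟨h1.add h1', h2.add h2', h3.add h3'⟩, fun x hx => ?_, fun x hx => ?_⟩
  · exact ⟨x, hx, 0, h2'.zero_mem hL, add_zero x⟩
  · exact ⟨0, h2.zero_mem hK, x, hx, zero_add x⟩

/-- A minimax argument: if each functional in a convex compact set takes values below `ε` on a
convex set `C`, then a single point of `C` works for all of them. -/
theorem exists_forall_re_lt {K : Set (WeakBilin B)} (hK : Convex ℝ K) (hKc : IsCompact K)
    {C : Set E} (hC : Convex ℝ C) (hCn : C.Nonempty) {ε : ℝ}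
    (h : ∀ φ ∈ K, ∃ c ∈ C, (B φ c).re < ε) : ∃ c ∈ C, ∀ φ ∈ K, (B φ c).re < ε := by
  classical
  have := continuousSMul_real_weakBilin B
  rcases K.eq_empty_or_nonempty with rfl | hKn
  · exact ⟨_, hCn.some_mem, by simp⟩
  have hcont : ∀ c : E, Continuous fun φ : WeakBilin B => (B φ c).re := fun c =>
    Complex.continuous_re.comp (WeakBilin.eval_continuous B c)
  obtain ⟨s, hs⟩ := hKc.elim_finite_subcover (fun c : C => {φ : WeakBilin B | (B φ c).re < ε})
    (fun c => isOpen_lt (hcont c) continuous_const) (fun φ hφ => by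
      obtain ⟨c, hc, hlt⟩ := h φ hφ
      exact Set.mem_iUnion.2 ⟨⟨c, hc⟩, hlt⟩)
  have hsn : Nonempty s := by
    obtain ⟨φ, hφ⟩ := hKn
    obtain ⟨c, hc, -⟩ := Set.mem_iUnion₂.1 (hs hφ)
    exact ⟨⟨c, hc⟩⟩
  -- The payoff of a game: `φ` in `K` minimises, a mixture `w` of the finitely many points of the
  -- subcover maximises. The sign fits Sion's convention.
  let f : WeakBilin B → (s → ℝ) → ℝ := fun φ w => -∑ i, w i * (B φ (i : C)).re
  have hadd : ∀ (w : s → ℝ) (φ ψ : WeakBilin B) (p q : ℝ),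
      f (p • φ + q • ψ) w = p * f φ w + q * f ψ w := by
    intro w φ ψ p q
    have : ∀ c : E, (B (p • φ + q • ψ) c).re = p * (B φ c).re + q * (B ψ c).re := by
      intro c
      have h1 : ∀ x y : F, (B (p • x + q • y) c).re = p * (B x c).re + q * (B y c).re := by
        intro x y
        rw [← Complex.coe_smul p x, ← Complex.coe_smul q y]
        simp
      exact h1 φ ψ
    simp only [f, this, mul_add, Finset.sum_add_distrib, neg_add, mul_neg, Finset.mul_sum]
    congr 2 <;> exact Finset.sum_congr rfl fun i _ => by ring
  have hadd' : ∀ (φ : WeakBilin B) (v w : s → ℝ) (p q : ℝ),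
      f φ (p • v + q • w) = p * f φ v + q * f φ w := by
    intro φ v w p q
    simp only [f, Pi.add_apply, Pi.smul_apply, smul_eq_mul, add_mul, Finset.sum_add_distrib,
      neg_add, mul_neg, Finset.mul_sum]
    congr 2 <;> exact Finset.sum_congr rfl fun i _ => by ring
  obtain ⟨a, ha, w, hw, hsad⟩ := Sion.exists_isSaddlePointOn (X := K) (Y := stdSimplex ℝ s) (f := f)
    hKn hK hKc
    (fun w _ => (show Continuous fun φ => f φ w by fun_prop).lowerSemicontinuous.lowerSemicontinuousOn _)
    (fun w _ => ConvexOn.quasiconvexOn ⟨hK, fun φ _ ψ _ p q _ _ _ => (hadd w φ ψ p q).le⟩)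
    (convex_stdSimplex ℝ s) ⟨_, single_mem_stdSimplex ℝ hsn.some⟩ (isCompact_stdSimplex ℝ s)
    (fun φ _ => (show Continuous fun w => f φ w by fun_prop).upperSemicontinuous.upperSemicontinuousOn _)
    (fun φ _ => ConcaveOn.quasiconcaveOn
      ⟨convex_stdSimplex ℝ s, fun v _ w _ p q _ _ _ => (hadd' φ v w p q).ge⟩)
  refine ⟨∑ i, w i • ((i : C) : E), hC.sum_mem (fun i _ => hw.1 i) hw.2 fun i _ => i.1.2,
    fun φ hφ => ?_⟩
  -- Some pure strategy `c` is good against the saddle point `a`; the saddle inequality then makes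
  -- the mixture `w` at least as good against every `φ`.
  obtain ⟨c, hc, hlt⟩ := Set.mem_iUnion₂.1 (hs ha)
  have h1 := hsad φ hφ (Pi.single ⟨c, hc⟩ 1) (single_mem_stdSimplex ℝ _)
  have h2 : f a (Pi.single ⟨c, hc⟩ 1) = -(B a c).re := by
    simp [f, Pi.single_apply]
  have h3 : f φ w = -(B φ (∑ i, w i • ((i : C) : E))).re := by
    simp [f]
  rw [h2, h3] at h1
  have : (B a c).re < ε := hlt
  linarith

/-- For a convex set, membership in the Mackey closure can be tested on single functionals. -/
theorem mem_closure_mackeyTopology {C : Set E} (hC : Convex ℝ C) {a : E}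
    (h : ∀ φ : F, ∀ ε > 0, ∃ c ∈ C, (B φ c).re < (B φ a).re + ε) :
    a ∈ closure[mackeyTopology B] C := by
  have hCn : C.Nonempty := by
    obtain ⟨c, hc, -⟩ := h 0 1 one_pos
    exact ⟨c, hc⟩
  have key := (UniformOnFun.hasBasis_nhds_of_basis (WeakBilin B) ℂ (mackeyFamily B)
    (UniformOnFun.ofFun (mackeyFamily B) fun f : WeakBilin B => (B f a : ℂ))
    (mackeyFamily_nonempty B) (mackeyFamily_directedOn B) Metric.uniformity_basis_dist).comap
      (fun e : E => UniformOnFun.ofFun (mackeyFamily B) fun f : WeakBilin B => (B f e : ℂ))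
  rw [← nhds_induced] at key
  refine (@mem_closure_iff_nhds_basis E (mackeyTopology B) _ _ _ _ _ key).2 ?_
  rintro ⟨K, ε⟩ ⟨⟨hK, hKb, hKc⟩, hε : 0 < ε⟩
  obtain ⟨_, ⟨c, hc, rfl⟩, hlt⟩ := exists_forall_re_lt B hK hKc (C := (fun c => c - a) '' C) (ε := ε)
    (by simpa [sub_eq_add_neg, add_comm] using hC.translate (-a))
    (hCn.image _) (fun φ _ => by
      obtain ⟨c, hc, hlt⟩ := h φ ε hε
      refine ⟨_, ⟨c, hc, rfl⟩, ?_⟩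
      simp only [map_sub, Complex.sub_re]
      linarith)
  refine ⟨c, hc, fun φ hφ => ?_⟩
  change dist (B φ c) (B φ a) < ε
  rw [dist_eq_norm, ← map_sub]
  set z := B φ (c - a) with hz
  by_cases h0 : z = 0
  · simpa [h0] using hε
  have hn : ‖z‖ ≠ 0 := norm_ne_zero_iff.2 h0
  -- Since `K` is balanced, `φ` may be rotated so that its value at `c - a` becomes `‖z‖`; a bound
  -- on real parts thus bounds the modulus.
  have hmem : ((starRingEnd ℂ z / ‖z‖ : ℂ) • φ) ∈ K := by
    refine hKb.smul_mem ?_ hφ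
    simp [hn]
  have h1 := hlt _ hmem
  have h2 : B ((starRingEnd ℂ z / ‖z‖ : ℂ) • φ) (c - a) = (starRingEnd ℂ z / ‖z‖ : ℂ) * z := by
    erw [map_smul]
    rfl
  erw [h2] at h1
  rw [div_mul_eq_mul_div, mul_comm, Complex.mul_conj, Complex.normSq_eq_norm_sq] at h1
  rw [← Complex.ofReal_div, Complex.ofReal_re, pow_two, mul_div_assoc, div_self hn, mul_one] at h1
  exact h1

/-- Each functional in the pairing is Mackey continuous. -/
theorem continuous_mackeyTopology_apply (φ : F) :
    Continuous[mackeyTopology B, inferInstance] fun e : E => B φ e := by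
  let ψ : WeakBilin B := φ
  -- The disc spanned by `φ` belongs to the family, and evaluation at its point `φ` is continuous
  -- for uniform convergence on it.
  let K : Set (WeakBilin B) := (fun c : ℂ => c • ψ) '' Metric.closedBall 0 1
  have hK : K ∈ mackeyFamily B := by
    refine ⟨?_, ?_, ?_⟩
    · exact (convex_closedBall (0 : ℂ) 1).is_linear_image
        ⟨fun x y => add_smul x y _, fun r x => smul_assoc r x _⟩
    · rintro r hr _ ⟨_, ⟨c, hc, rfl⟩, rfl⟩
      refine ⟨r * c, ?_, mul_smul r c _⟩
      rw [mem_closedBall_zero_iff] at hc ⊢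
      rw [norm_mul]
      exact mul_le_one₀ hr (norm_nonneg _) hc
    · exact (isCompact_closedBall (0 : ℂ) 1).image (continuous_id.smul continuous_const)
  let _ : TopologicalSpace E := mackeyTopology B
  have h1 := (UniformOnFun.uniformContinuous_eval_of_mem (s := K) (x := ψ) ℂ (mackeyFamily B)
    ⟨1, by simp, one_smul ℂ _⟩ hK).continuous
  exact h1.comp (continuous_induced_dom (f := fun e : E =>
    UniformOnFun.ofFun (mackeyFamily B) fun f : WeakBilin B => (B f e : ℂ)))

end Mackey

/-! ### Finite corners and Birkhoff's theorem -/

section Birkhoff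

/-- The real doubly substochastic infinite matrices. -/
def substochastic : Set (ℕ → ℕ → ℝ) :=
  {A | (∀ m k, 0 ≤ A m k) ∧ (∀ m (s : Finset ℕ), ∑ k ∈ s, A m k ≤ 1) ∧
    ∀ k (s : Finset ℕ), ∑ m ∈ s, A m k ≤ 1}

/-- The matrix of a permutation, with a `1` at each position `(ρ k, k)`. -/
def permMat (ρ : Equiv.Perm ℕ) (m k : ℕ) : ℝ := if ρ k = m then 1 else 0

theorem permMat_mem_substochastic (ρ : Equiv.Perm ℕ) : permMat ρ ∈ substochastic := by
  refine ⟨fun m k => ?_, fun m s => ?_, fun k s => ?_⟩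
  · unfold permMat; split_ifs <;> norm_num
  · have : ∀ k, permMat ρ m k = if ρ.symm m = k then 1 else 0 := fun k => by
      unfold permMat
      congr 1
      rw [Equiv.symm_apply_eq, eq_comm (a := m)]
    simp only [this, Finset.sum_ite_eq]
    split_ifs <;> norm_num
  · simp only [permMat, Finset.sum_ite_eq]
    split_ifs <;> norm_num

theorem viaFintypeEmbedding_mem_FS {α : Type*} [Fintype α] [DecidableEq α] (σ : Equiv.Perm α)
    (f : α ↪ ℕ) : σ.viaFintypeEmbedding f ∈ FS := by
  have h : ∀ᶠ n in Filter.atTop, n ∉ Set.range f := by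
    rw [← Nat.cofinite_eq_atTop]
    exact (Set.finite_range f).compl_mem_cofinite
  filter_upwards [h] with n hn
  exact σ.viaFintypeEmbedding_apply_notMem_range f hn

/-- A doubly substochastic matrix is the corner of a doubly stochastic one. -/
theorem fromBlocks_mem_doublyStochastic {n : Type*} [Fintype n] [DecidableEq n]
    (T : Matrix n n ℝ) (h0 : ∀ i j, 0 ≤ T i j) (hr : ∀ i, ∑ j, T i j ≤ 1)
    (hc : ∀ j, ∑ i, T i j ≤ 1) :
    Matrix.fromBlocks T (Matrix.diagonal fun i => 1 - ∑ j, T i j)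
      (Matrix.diagonal fun j => 1 - ∑ i, T i j) T.transpose ∈ doublyStochastic ℝ (n ⊕ n) := by
  rw [mem_doublyStochastic_iff_sum]
  refine ⟨?_, ?_, ?_⟩
  · rintro (i | i) (j | j)
    · exact h0 i j
    · by_cases h : i = j
      · subst h; simpa using hr i
      · simp [h]
    · by_cases h : i = j
      · subst h; simpa using hc i
      · simp [h]
    · exact h0 j i
  -- The diagonal blocks hold the row and column defects of `T`; a row of the transpose is a column
  -- of `T`, so each defect completes its line to 1.
  · rintro (i | i) <;> simp [Matrix.diagonal_apply]
  · rintro (i | i) <;> simp [Matrix.diagonal_apply]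

/-- Every finite corner of a doubly substochastic matrix agrees with a convex combination of
finitary permutation matrices. -/
theorem exists_weights_corner {A : ℕ → ℕ → ℝ} (hA : A ∈ substochastic) (N : ℕ) :
    ∃ w : Equiv.Perm (Fin N ⊕ Fin N) → ℝ, ∃ ρ : Equiv.Perm (Fin N ⊕ Fin N) → Equiv.Perm ℕ,
      (∀ σ, 0 ≤ w σ) ∧ ∑ σ, w σ = 1 ∧ (∀ σ, ρ σ ∈ FS) ∧
      ∀ m < N, ∀ k < N, ∑ σ, w σ * permMat (ρ σ) m k = A m k := by
  have hsum : ∀ g : ℕ → ℝ, ∑ i : Fin N, g i = ∑ i ∈ Finset.range N, g i := fun g =>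
    Fin.sum_univ_eq_sum_range g N
  -- The corner is transposed because `Equiv.Perm.permMatrix` has its ones at `(k, σ k)`, whereas
  -- `permMat` has them at `(ρ k, k)`.
  obtain ⟨w, hw0, hw1, hw⟩ := exists_eq_sum_perm_of_mem_doublyStochastic
    (fromBlocks_mem_doublyStochastic (fun i j : Fin N => A j i) (fun i j => hA.1 j i)
      (fun i => by rw [hsum fun j => A j i]; exact hA.2.2 i _)
      (fun j => by rw [hsum fun i => A j i]; exact hA.2.1 j _))
  -- The left summand goes to the indices below `N`, the right one to the next `N`; all other
  -- integers stay fixed.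
  let f : Fin N ⊕ Fin N ↪ ℕ := finSumFinEquiv.toEmbedding.trans Fin.valEmbedding
  refine ⟨w, fun σ => σ.viaFintypeEmbedding f, hw0, hw1,
    fun σ => viaFintypeEmbedding_mem_FS σ f, fun m hm k hk => ?_⟩
  have h1 : (∑ σ, w σ • σ.permMatrix ℝ) (Sum.inl ⟨k, hk⟩) (Sum.inl ⟨m, hm⟩) = A m k := by
    rw [hw]
    rfl
  simp only [Matrix.sum_apply, Matrix.smul_apply, smul_eq_mul] at h1
  rw [← h1]
  refine Finset.sum_congr rfl fun σ _ => ?_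
  have hfk : f (Sum.inl ⟨k, hk⟩) = k := by simp [f]
  have hfm : f (Sum.inl ⟨m, hm⟩) = m := by simp [f]
  have h2 : (σ.viaFintypeEmbedding f) k = f (σ (Sum.inl ⟨k, hk⟩)) := by
    conv_lhs => rw [← hfk]
    exact σ.viaFintypeEmbedding_apply_image f _
  congr 1
  simp only [permMat, h2]
  have h3 : σ.permMatrix ℝ (Sum.inl ⟨k, hk⟩) (Sum.inl ⟨m, hm⟩) =
      if σ (Sum.inl ⟨k, hk⟩) = Sum.inl ⟨m, hm⟩ then 1 else 0 := by
    simp [Equiv.Perm.permMatrix, PEquiv.toMatrix_apply, Equiv.toPEquiv_apply]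
  refine Eq.trans ?_ h3.symm
  conv_lhs => rw [← hfm]
  simp only [f.injective.eq_iff]

end Birkhoff

/-! ### The closed convex hulls -/

section Hull

variable {H : Type*} [NormedAddCommGroup H] [InnerProductSpace ℂ H]

/-- The matrix of the real parts of the coefficients. -/
def reMat (e : HilbertBasis ℕ ℂ H) : (H →L[ℂ] H) →ₗ[ℝ] (ℕ → ℕ → ℝ) where
  toFun a m k := (coeff e a m k).re
  map_add' a b := by
    ext m k
    simp [coeff]
  map_smul' r a := by
    ext m k
    simp [coeff, ← Complex.coe_smul]

theorem reMat_apply (e : HilbertBasis ℕ ℂ H) (a : H →L[ℂ] H) (m k : ℕ) :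
    reMat e a m k = (coeff e a m k).re := rfl

/-- Bounds on finite partial sums, unlike a bound on a series, are visibly closed under entrywise
limits. -/
theorem summable_and_tsum_le_one_iff {g : ℕ → ℂ} (hg : ∀ k, 0 ≤ g k) :
    (Summable g ∧ ∑' k, g k ≤ 1) ↔ ∀ s : Finset ℕ, ∑ k ∈ s, (g k).re ≤ 1 := by
  have h0 : ∀ k, 0 ≤ (g k).re := fun k => (Complex.nonneg_iff.1 (hg k)).1
  obtain ⟨r, rfl⟩ : ∃ r : ℕ → ℝ, g = fun k => (r k : ℂ) :=
    ⟨fun k => (g k).re, funext fun k => Complex.ext rfl (Complex.nonneg_iff.1 (hg k)).2.symm⟩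
  simp only [Complex.ofReal_re] at h0 ⊢
  rw [Complex.summable_ofReal, ← Complex.ofReal_tsum]
  norm_cast
  constructor
  · rintro ⟨h1, h2⟩ s
    exact (h1.sum_le_tsum s fun k _ => h0 k).trans h2
  · intro h
    have h1 := summable_of_sum_le h0 h
    exact ⟨h1, h1.tsum_le_of_sum_le h⟩

theorem mem_DSS_iff {e : HilbertBasis ℕ ℂ H} {a : H →L[ℂ] H} :
    a ∈ DSS e ↔ (∀ m k, (coeff e a m k).im = 0) ∧ reMat e a ∈ substochastic := by
  constructor
  · rintro ⟨h0, h1, h2⟩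
    refine ⟨fun m k => (Complex.nonneg_iff.1 (h0 m k)).2.symm,
      fun m k => (Complex.nonneg_iff.1 (h0 m k)).1, fun m => ?_, fun k => ?_⟩
    · exact (summable_and_tsum_le_one_iff (h0 m)).1 (h1 m)
    · exact (summable_and_tsum_le_one_iff fun m => h0 m k).1 (h2 k)
  · rintro ⟨h, h0, h1, h2⟩
    have h0' : ∀ m k, 0 ≤ coeff e a m k := fun m k =>
      Complex.nonneg_iff.2 ⟨h0 m k, (h m k).symm⟩
    exact ⟨h0', fun m => (summable_and_tsum_le_one_iff (h0' m)).2 (h1 m),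
      fun k => (summable_and_tsum_le_one_iff fun m => h0' m k).2 (h2 k)⟩

theorem convex_substochastic : Convex ℝ substochastic := by
  rintro A ⟨hA0, hA1, hA2⟩ B ⟨hB0, hB1, hB2⟩ p q hp hq hpq
  refine ⟨fun m k => ?_, fun m s => ?_, fun k s => ?_⟩
  · exact add_nonneg (mul_nonneg hp (hA0 m k)) (mul_nonneg hq (hB0 m k))
  · simp only [Pi.add_apply, Pi.smul_apply, smul_eq_mul, Finset.sum_add_distrib, ← Finset.mul_sum]
    nlinarith [hA1 m s, hB1 m s]
  · simp only [Pi.add_apply, Pi.smul_apply, smul_eq_mul, Finset.sum_add_distrib, ← Finset.mul_sum]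
    nlinarith [hA2 k s, hB2 k s]

theorem isClosed_substochastic : IsClosed substochastic := by
  have h : substochastic = (⋂ m, ⋂ k, {A : ℕ → ℕ → ℝ | 0 ≤ A m k}) ∩
      ((⋂ m, ⋂ s : Finset ℕ, {A : ℕ → ℕ → ℝ | ∑ k ∈ s, A m k ≤ 1}) ∩
        ⋂ k, ⋂ s : Finset ℕ, {A : ℕ → ℕ → ℝ | ∑ m ∈ s, A m k ≤ 1}) := by
    ext A
    simp [substochastic]
  rw [h]
  refine (isClosed_iInter fun m => isClosed_iInter fun k => ?_).inter
    ((isClosed_iInter fun m => isClosed_iInter fun s => ?_).inter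
      (isClosed_iInter fun m => isClosed_iInter fun s => ?_))
  · exact isClosed_le continuous_const (by fun_prop)
  · exact isClosed_le (by fun_prop) continuous_const
  · exact isClosed_le (by fun_prop) continuous_const

theorem convex_DSS (e : HilbertBasis ℕ ℂ H) : Convex ℝ (DSS e) := by
  intro a ha b hb p q hp hq hpq
  rw [mem_DSS_iff] at *
  refine ⟨fun m k => ?_, ?_⟩
  · have h1 := ha.1 m k
    have h2 := hb.1 m k
    simp only [coeff] at h1 h2 ⊢
    simp [← Complex.coe_smul, h1, h2]
  · rw [map_add, map_smul, map_smul]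
    exact convex_substochastic ha.2 hb.2 hp hq hpq

theorem continuous_weakOperator_coeff (e : HilbertBasis ℕ ℂ H) (m k : ℕ) :
    Continuous[weakOperator H, inferInstance] fun a : H →L[ℂ] H => coeff e a m k :=
  let _ : TopologicalSpace (H →L[ℂ] H) := weakOperator H
  (ContinuousLinearMapWOT.continuous_dual_apply (σ := RingHom.id ℂ) (e k) (innerSL ℂ (e m))).comp
    (continuous_induced_dom (f := fun a : H →L[ℂ] H =>
      (ContinuousLinearMapWOT.ofCLM a : H →WOT[ℂ] H)))

theorem isClosed_weakOperator_DSS (e : HilbertBasis ℕ ℂ H) : IsClosed[weakOperator H] (DSS e) := by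
  let _ : TopologicalSpace (H →L[ℂ] H) := weakOperator H
  have h : DSS e = (⋂ m, ⋂ k, {a | (coeff e a m k).im = 0}) ∩ reMat e ⁻¹' substochastic := by
    ext a
    simp [mem_DSS_iff]
  rw [h]
  refine (isClosed_iInter fun m => isClosed_iInter fun k => ?_).inter
    (isClosed_substochastic.preimage ?_)
  · exact isClosed_eq (Complex.continuous_im.comp (continuous_weakOperator_coeff e m k))
      continuous_const
  · exact continuous_pi fun m => continuous_pi fun k =>
      Complex.continuous_re.comp (continuous_weakOperator_coeff e m k)

/-- The rank one functional `a ↦ ⟨a x, y⟩` lies in the predual. -/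
theorem exists_predual_apply_eq (x y : H) :
    ∃ φ : predual H, ∀ a : H →L[ℂ] H, (φ : Module.Dual ℂ (H →L[ℂ] H)) a = ⟪y, a x⟫_ℂ := by
  refine ⟨⟨{ toFun := fun a => ⟪y, a x⟫_ℂ
             map_add' := fun a b => by simp
             map_smul' := fun c a => by simp },
    Pi.single 0 x, Pi.single 0 y, ?_, ?_, fun a => ?_⟩, fun a => rfl⟩
  · exact summable_of_ne_finset_zero (s := {0}) fun n hn => by
      simp [Pi.single_eq_of_ne (Finset.notMem_singleton.1 hn)]
  · exact summable_of_ne_finset_zero (s := {0}) fun n hn => by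
      simp [Pi.single_eq_of_ne (Finset.notMem_singleton.1 hn)]
  · have := hasSum_single (f := fun n : ℕ =>
      ⟪(Pi.single 0 y : ℕ → H) n, a ((Pi.single 0 x : ℕ → H) n)⟫_ℂ) 0 fun n hn => by
        simp [Pi.single_eq_of_ne hn]
    simpa using this

/-- A bounded sequence of functionals that tends to zero on a basis tends to zero pointwise. -/
theorem tendsto_zero_of_basis (e : HilbertBasis ℕ ℂ H) {L : ℕ → H →L[ℂ] ℂ} {C : ℝ}
    (hL : ∀ n, ‖L n‖ ≤ C) (h : ∀ k, Filter.Tendsto (fun n => L n (e k)) Filter.atTop (𝓝 0))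
    (x : H) : Filter.Tendsto (fun n => L n x) Filter.atTop (𝓝 0) := by
  let S : Submodule ℂ H :=
    { carrier := {x | Filter.Tendsto (fun n => L n x) Filter.atTop (𝓝 0)}
      add_mem' := fun {x y} hx hy => by
        simpa using Filter.Tendsto.add (f := fun n => L n x) (g := fun n => L n y) hx hy
      zero_mem' := by simp
      smul_mem' := fun c x hx => by
        simpa using Filter.Tendsto.const_mul (f := fun n => L n x) c hx }
  have hS : Submodule.span ℂ (Set.range e) ≤ S := by
    rw [Submodule.span_le]
    rintro _ ⟨k, rfl⟩
    exact h k
  have hx : x ∈ closure (Submodule.span ℂ (Set.range e) : Set H) := by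
    have : x ∈ (Submodule.span ℂ (Set.range e)).topologicalClosure := by
      rw [e.dense_span]
      trivial
    exact this
  have hC : 0 ≤ C := (norm_nonneg _).trans (hL 0)
  rw [Metric.tendsto_atTop]
  intro ε hε
  -- `C + 1` keeps the denominator positive when `C = 0`.
  obtain ⟨y, hy, hxy⟩ := Metric.mem_closure_iff.1 hx (ε / (2 * (C + 1))) (by positivity)
  obtain ⟨N, hN⟩ := Metric.tendsto_atTop.1 (hS hy) (ε / 2) (half_pos hε)
  refine ⟨N, fun n hn => ?_⟩
  have h1 := hN n hn
  rw [dist_zero_right] at h1 ⊢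
  rw [dist_eq_norm] at hxy
  have h2 : ‖L n (x - y)‖ ≤ ε / 2 :=
    calc ‖L n (x - y)‖ ≤ (C + 1) * (ε / (2 * (C + 1))) :=
          (L n).le_of_opNorm_le_of_le ((hL n).trans (by linarith)) hxy.le
      _ = ε / 2 := by field_simp
  calc ‖L n x‖ = ‖L n (x - y) + L n y‖ := by rw [map_sub, sub_add_cancel]
    _ ≤ ‖L n (x - y)‖ + ‖L n y‖ := norm_add_le _ _
    _ < ε := by linarith

/-- The basis criterion is used twice, first in `x` against each `e m`, then in `y`; conjugation
makes the second dependence linear. -/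
theorem tendsto_inner_zero_of_coeff (e : HilbertBasis ℕ ℂ H) {d : ℕ → H →L[ℂ] H} {C : ℝ}
    (hd : ∀ n, ‖d n‖ ≤ C)
    (h : ∀ m k, Filter.Tendsto (fun n => coeff e (d n) m k) Filter.atTop (𝓝 0)) (x y : H) :
    Filter.Tendsto (fun n => ⟪y, d n x⟫_ℂ) Filter.atTop (𝓝 0) := by
  have h1 : ∀ m, Filter.Tendsto (fun n => ⟪e m, d n x⟫_ℂ) Filter.atTop (𝓝 0) := fun m =>
    tendsto_zero_of_basis e (L := fun n => (innerSL ℂ (e m)).comp (d n)) (C := C)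
      (fun n => by
        refine (ContinuousLinearMap.opNorm_comp_le _ _).trans ?_
        rw [innerSL_apply_norm, e.orthonormal.1 m, one_mul]
        exact hd n)
      (fun k => h m k) x
  have h2 : Filter.Tendsto (fun n => ⟪d n x, y⟫_ℂ) Filter.atTop (𝓝 0) :=
    tendsto_zero_of_basis e (L := fun n => innerSL ℂ (d n x)) (C := C * ‖x‖)
      (fun n => by
        rw [innerSL_apply_norm]
        exact (d n).le_of_opNorm_le (hd n) x)
      (fun k => by
        have := (Complex.continuous_conj.tendsto 0).comp (h1 k)
        simpa [Function.comp_def] using this) y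
  have := (Complex.continuous_conj.tendsto 0).comp h2
  simpa [Function.comp_def] using this

/-- On bounded sequences, convergence of the coefficients implies `σ`-weak convergence. -/
theorem tendsto_predual_zero_of_coeff (e : HilbertBasis ℕ ℂ H) {d : ℕ → H →L[ℂ] H} {C : ℝ}
    (hd : ∀ n, ‖d n‖ ≤ C)
    (h : ∀ m k, Filter.Tendsto (fun n => coeff e (d n) m k) Filter.atTop (𝓝 0))
    {f : Module.Dual ℂ (H →L[ℂ] H)} (hf : f ∈ predual H) :
    Filter.Tendsto (fun n => f (d n)) Filter.atTop (𝓝 0) := by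
  obtain ⟨x, y, hx, hy, hsum⟩ := hf
  have hC : 0 ≤ C := (norm_nonneg _).trans (hd 0)
  -- The dominating series comes from `‖x j‖ * ‖y j‖ ≤ ‖x j‖ ^ 2 + ‖y j‖ ^ 2`.
  have key := tendsto_tsum_of_dominated_convergence (𝓕 := Filter.atTop)
    (f := fun n j => ⟪y j, d n (x j)⟫_ℂ) (g := fun _ => 0)
    (bound := fun j => C * (‖x j‖ ^ 2 + ‖y j‖ ^ 2)) ((hx.add hy).mul_left C)
    (fun j => tendsto_inner_zero_of_coeff e hd h (x j) (y j))
    (Filter.Eventually.of_forall fun n j => ?_)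
  · simpa [fun n => (hsum (d n)).tsum_eq] using key
  · calc ‖⟪y j, d n (x j)⟫_ℂ‖ ≤ ‖y j‖ * ‖d n (x j)‖ := norm_inner_le_norm _ _
      _ ≤ ‖y j‖ * (C * ‖x j‖) := by gcongr; exact (d n).le_of_opNorm_le (hd n) _
      _ = C * (‖x j‖ * ‖y j‖) := by ring
      _ ≤ C * (‖x j‖ ^ 2 + ‖y j‖ ^ 2) := by
        gcongr
        nlinarith [sq_nonneg (‖x j‖ - ‖y j‖), sq_nonneg (‖x j‖), sq_nonneg (‖y j‖)]

variable [CompleteSpace H]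

theorem arensMackey_le_weakOperator : arensMackey H ≤ weakOperator H := by
  refine continuous_iff_le_induced.1 ?_
  let _ : TopologicalSpace (H →L[ℂ] H) := arensMackey H
  refine ContinuousLinearMapWOT.continuous_of_dual_apply_continuous fun x y => ?_
  obtain ⟨φ, hφ⟩ := exists_predual_apply_eq x ((InnerProductSpace.toDual ℂ H).symm y)
  refine (continuous_mackeyTopology_apply (predual H).subtype φ).congr fun a => ?_
  rw [Submodule.subtype_apply, hφ, InnerProductSpace.toDual_symm_apply]
  rfl

theorem coeff_permOp (e : HilbertBasis ℕ ℂ H) (ρ : Equiv.Perm ℕ) (m k : ℕ) :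
    coeff e (permOp e ρ) m k = (permMat ρ m k : ℂ) := by
  rw [coeff, permOp_apply, orthonormal_iff_ite.1 e.orthonormal, permMat]
  by_cases h : ρ k = m
  · simp [h]
  · simp [h, Ne.symm h]

theorem reMat_permOp (e : HilbertBasis ℕ ℂ H) (ρ : Equiv.Perm ℕ) :
    reMat e (permOp e ρ) = permMat ρ := by
  ext m k
  rw [reMat_apply, coeff_permOp, Complex.ofReal_re]

theorem permOp_mem_DSS (e : HilbertBasis ℕ ℂ H) (ρ : Equiv.Perm ℕ) : permOp e ρ ∈ DSS e := by
  rw [mem_DSS_iff, reMat_permOp]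
  refine ⟨fun m k => ?_, permMat_mem_substochastic ρ⟩
  rw [coeff_permOp, Complex.ofReal_im]

theorem norm_permOp_le (e : HilbertBasis ℕ ℂ H) (ρ : Equiv.Perm ℕ) : ‖permOp e ρ‖ ≤ 1 := by
  refine ContinuousLinearMap.opNorm_le_bound _ zero_le_one fun x => ?_
  rw [one_mul]
  exact ((e.repr.trans (permBasis e ρ).repr.symm).norm_map x).le

/-- A doubly substochastic operator is approximated, corner by corner, by convex combinations of
finitary permutations. -/
theorem exists_mem_convexHull_coeff_eq (e : HilbertBasis ℕ ℂ H) {a : H →L[ℂ] H} (ha : a ∈ DSS e)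
    (N : ℕ) : ∃ b ∈ convexHull ℝ (permOp e '' FS), ‖b‖ ≤ 1 ∧
      ∀ m < N, ∀ k < N, coeff e b m k = coeff e a m k := by
  obtain ⟨him, hA⟩ := mem_DSS_iff.1 ha
  obtain ⟨w, ρ, hw0, hw1, hρ, hcorner⟩ := exists_weights_corner hA N
  have hmem : ∑ σ, w σ • permOp e (ρ σ) ∈ convexHull ℝ (permOp e '' FS) :=
    (convex_convexHull ℝ _).sum_mem (fun σ _ => hw0 σ) hw1
      fun σ _ => subset_convexHull ℝ _ ⟨ρ σ, hρ σ, rfl⟩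
  refine ⟨_, hmem, ?_, fun m hm k hk => ?_⟩
  · have : convexHull ℝ (permOp e '' FS) ⊆ Metric.closedBall 0 1 := by
      refine convexHull_min ?_ (convex_closedBall 0 1)
      rintro _ ⟨τ, -, rfl⟩
      simpa using norm_permOp_le e τ
    simpa using this hmem
  -- The corner identity only compares real parts; membership in `DSS` makes the imaginary parts
  -- vanish.
  · have hb : (∑ σ, w σ • permOp e (ρ σ)) ∈ DSS e :=
      convexHull_min (by rintro _ ⟨τ, -, rfl⟩; exact permOp_mem_DSS e τ) (convex_DSS e) hmem
    refine Complex.ext ?_ (((mem_DSS_iff.1 hb).1 m k).trans (him m k).symm)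
    have := hcorner m hm k hk
    rw [reMat_apply] at this
    rw [← this, ← reMat_apply, map_sum]
    simp [reMat_permOp]

theorem DSS_subset_closedHull_arensMackey (e : HilbertBasis ℕ ℂ H) :
    DSS e ⊆ closedHull (arensMackey H) (permOp e '' FS) := by
  intro a ha
  choose b hb hb1 hbc using exists_mem_convexHull_coeff_eq e ha
  refine mem_closure_mackeyTopology _ (convex_convexHull ℝ _) fun φ ε hε => ?_
  have hlim := tendsto_predual_zero_of_coeff e (d := fun n => b n - a) (C := 1 + ‖a‖)
    (fun n => (norm_sub_le _ _).trans (by gcongr; exact hb1 n))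
    (fun m k => by
      -- Each coefficient of `b n - a` is exactly 0 once `n > max m k`.
      refine tendsto_const_nhds.congr' ?_
      filter_upwards [Filter.eventually_gt_atTop (max m k)] with n hn
      have := hbc n m ((le_max_left _ _).trans_lt hn) k ((le_max_right _ _).trans_lt hn)
      simp only [coeff] at this ⊢
      simp [this]) φ.2
  obtain ⟨n, hn⟩ := ((Complex.continuous_re.tendsto 0).comp hlim).eventually
    (gt_mem_nhds (show (0 : ℂ).re < ε by simpa using hε)) |>.exists
  refine ⟨b n, hb n, ?_⟩
  simp only [Function.comp_apply, map_sub, Complex.sub_re] at hn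
  change ((φ : Module.Dual ℂ (H →L[ℂ] H)) (b n)).re < ((φ : Module.Dual ℂ (H →L[ℂ] H)) a).re + ε
  linarith

theorem closedHull_weakOperator_subset_DSS (e : HilbertBasis ℕ ℂ H) :
    closedHull (weakOperator H) (permOp e '' FS) ⊆ DSS e :=
  @closure_minimal _ (weakOperator H) _ _
    (convexHull_min (by rintro _ ⟨τ, -, rfl⟩; exact permOp_mem_DSS e τ) (convex_DSS e))
    (isClosed_weakOperator_DSS e)

theorem closedHull_arensMackey_subset (s : Set (H →L[ℂ] H)) :
    closedHull (arensMackey H) s ⊆ closedHull (weakOperator H) s :=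
  closure.mono arensMackey_le_weakOperator

end Hull

/-! ### Schur's test: substochastic matrices are contractions -/

section Schur

variable {A : ℕ → ℕ → ℝ}

theorem le_one_of_mem_substochastic (hA : A ∈ substochastic) (m k : ℕ) : A m k ≤ 1 := by
  simpa using hA.2.1 m {k}

theorem summable_norm_sq (x : lp (fun _ : ℕ => ℂ) 2) : Summable fun k => ‖x k‖ ^ 2 := by
  simpa using (lp.memℓp x).summable (by norm_num)

theorem tsum_norm_sq (x : lp (fun _ : ℕ => ℂ) 2) : ∑' k, ‖x k‖ ^ 2 = ‖x‖ ^ 2 := by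
  simpa using (lp.norm_rpow_eq_tsum (p := 2) (by norm_num) x).symm

theorem summable_mul_norm_sq (hA : A ∈ substochastic) (x : lp (fun _ : ℕ => ℂ) 2) (m : ℕ) :
    Summable fun k => A m k * ‖x k‖ ^ 2 :=
  (summable_norm_sq x).of_nonneg_of_le (fun k => mul_nonneg (hA.1 m k) (sq_nonneg _)) fun k =>
    mul_le_of_le_one_left (sq_nonneg _) (le_one_of_mem_substochastic hA m k)

theorem summable_row_mul (hA : A ∈ substochastic) (x : lp (fun _ : ℕ => ℂ) 2) (m : ℕ) :
    Summable fun k => (A m k : ℂ) * x k := by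
  refine Summable.of_norm_bounded
    ((summable_of_sum_le (hA.1 m) (hA.2.1 m)).add (summable_mul_norm_sq hA x m)) fun k => ?_
  rw [norm_mul, Complex.norm_real, Real.norm_of_nonneg (hA.1 m k), ← mul_one_add]
  -- This is `t ≤ 1 + t ^ 2`, weighted by the summable row.
  exact mul_le_mul_of_nonneg_left (by nlinarith [sq_nonneg (‖x k‖ - 1), norm_nonneg (x k)])
    (hA.1 m k)

/-- Cauchy–Schwarz for the weights `A m k`, whose total mass in row `m` is at most 1. -/
theorem norm_row_mul_sq_le (hA : A ∈ substochastic) (x : lp (fun _ : ℕ => ℂ) 2) (m : ℕ) :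
    ‖∑' k, (A m k : ℂ) * x k‖ ^ 2 ≤ ∑' k, A m k * ‖x k‖ ^ 2 := by
  refine le_of_tendsto ((summable_row_mul hA x m).hasSum.norm.pow 2)
    (Filter.Eventually.of_forall fun s => ?_)
  have h1 : ‖∑ k ∈ s, (A m k : ℂ) * x k‖ ≤ ∑ k ∈ s, A m k * ‖x k‖ := by
    refine (norm_sum_le _ _).trans_eq (Finset.sum_congr rfl fun k _ => ?_)
    rw [norm_mul, Complex.norm_real, Real.norm_of_nonneg (hA.1 m k)]
  have h2 : (∑ k ∈ s, A m k * ‖x k‖) ^ 2 ≤ (∑ k ∈ s, A m k) * ∑ k ∈ s, A m k * ‖x k‖ ^ 2 :=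
    Finset.sum_sq_le_sum_mul_sum_of_sq_le_mul s (fun k _ => hA.1 m k)
      (fun k _ => mul_nonneg (hA.1 m k) (sq_nonneg _)) fun k _ => by
        rw [mul_pow, pow_two (A m k), mul_assoc]
  have h3 : 0 ≤ ∑ k ∈ s, A m k * ‖x k‖ ^ 2 :=
    Finset.sum_nonneg fun k _ => mul_nonneg (hA.1 m k) (sq_nonneg _)
  calc ‖∑ k ∈ s, (A m k : ℂ) * x k‖ ^ 2 ≤ (∑ k ∈ s, A m k * ‖x k‖) ^ 2 := by gcongr
    _ ≤ ∑ k ∈ s, A m k * ‖x k‖ ^ 2 := h2.trans (mul_le_of_le_one_left h3 (hA.2.1 m s))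
    _ ≤ _ := (summable_mul_norm_sq hA x m).sum_le_tsum s
      fun k _ => mul_nonneg (hA.1 m k) (sq_nonneg _)

/-- After the row estimate, exchanging the sums leaves column sums, which are at most 1. -/
theorem sum_norm_row_mul_sq_le (hA : A ∈ substochastic) (x : lp (fun _ : ℕ => ℂ) 2)
    (M : Finset ℕ) : ∑ m ∈ M, ‖∑' k, (A m k : ℂ) * x k‖ ^ 2 ≤ ‖x‖ ^ 2 := by
  calc ∑ m ∈ M, ‖∑' k, (A m k : ℂ) * x k‖ ^ 2 ≤ ∑ m ∈ M, ∑' k, A m k * ‖x k‖ ^ 2 :=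
        Finset.sum_le_sum fun m _ => norm_row_mul_sq_le hA x m
    _ = ∑' k, ∑ m ∈ M, A m k * ‖x k‖ ^ 2 :=
        (Summable.tsum_finsetSum fun m _ => summable_mul_norm_sq hA x m).symm
    _ ≤ ∑' k, ‖x k‖ ^ 2 := by
        refine Summable.tsum_le_tsum (fun k => ?_)
          (summable_sum fun m _ => summable_mul_norm_sq hA x m) (summable_norm_sq x)
        rw [← Finset.sum_mul]
        exact mul_le_of_le_one_left (sq_nonneg _) (hA.2.2 k M)
    _ = ‖x‖ ^ 2 := tsum_norm_sq x

/-- The operator on `ℓ²` given by a doubly substochastic matrix. -/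
def matrixOp (hA : A ∈ substochastic) : lp (fun _ : ℕ => ℂ) 2 →L[ℂ] lp (fun _ : ℕ => ℂ) 2 :=
  LinearMap.mkContinuous
    { toFun := fun x => ⟨fun m => ∑' k, (A m k : ℂ) * x k,
        memℓp_gen' (C := ‖x‖ ^ 2) fun M => by simpa using sum_norm_row_mul_sq_le hA x M⟩
      map_add' := fun x y => by
        ext m
        refine Eq.trans ?_ ((summable_row_mul hA x m).tsum_add (summable_row_mul hA y m))
        simp [mul_add]
      map_smul' := fun c x => by
        ext m
        simpa [mul_left_comm] using (summable_row_mul hA x m).tsum_mul_left c } 1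
    fun x => by
      rw [one_mul]
      refine lp.norm_le_of_forall_sum_le (by norm_num) (norm_nonneg x) fun M => ?_
      simpa using sum_norm_row_mul_sq_le hA x M

theorem matrixOp_apply (hA : A ∈ substochastic) (x : lp (fun _ : ℕ => ℂ) 2) (m : ℕ) :
    matrixOp hA x m = ∑' k, (A m k : ℂ) * x k := rfl

variable {H : Type*} [NormedAddCommGroup H] [InnerProductSpace ℂ H]

theorem exists_coeff_eq (e : HilbertBasis ℕ ℂ H) (hA : A ∈ substochastic) :
    ∃ a : H →L[ℂ] H, ∀ m k, coeff e a m k = (A m k : ℂ) := by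
  refine ⟨(e.repr.symm.toContinuousLinearEquiv : _ →L[ℂ] H).comp
    ((matrixOp hA).comp (e.repr.toContinuousLinearEquiv : H →L[ℂ] _)), fun m k => ?_⟩
  rw [coeff, ← e.repr_apply_apply]
  change e.repr (e.repr.symm (matrixOp hA (e.repr (e k)))) m = _
  rw [e.repr.apply_symm_apply, e.repr_self, matrixOp_apply, tsum_eq_single k]
  · simp
  · intro j hj
    simp [hj]

/-- This carries a decomposition of matrices back to operators, where extremality is tested. -/
theorem exists_mem_DSS_reMat_eq (e : HilbertBasis ℕ ℂ H) (hA : A ∈ substochastic) :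
    ∃ a ∈ DSS e, reMat e a = A := by
  obtain ⟨a, ha⟩ := exists_coeff_eq e hA
  have h : reMat e a = A := by
    ext m k
    rw [reMat_apply, ha, Complex.ofReal_re]
  refine ⟨a, mem_DSS_iff.2 ⟨fun m k => ?_, h ▸ hA⟩, h⟩
  rw [ha, Complex.ofReal_im]

end Schur

/-! ### Extreme points -/

section Extreme

theorem isCompact_substochastic : IsCompact substochastic := by
  refine (isCompact_univ_pi fun _ : ℕ => isCompact_univ_pi fun _ : ℕ =>
    isCompact_Icc (a := (0 : ℝ)) (b := 1)).of_isClosed_subset isClosed_substochastic ?_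
  exact fun A hA m _ k _ => ⟨hA.1 m k, le_one_of_mem_substochastic hA m k⟩

/-- In the product topology, agreement on growing corners is already convergence. -/
theorem substochastic_subset_closure :
    substochastic ⊆ closure (convexHull ℝ (permMat '' FS)) := by
  intro A hA
  choose w ρ hw0 hw1 hρ hcorner using exists_weights_corner hA
  refine mem_closure_of_tendsto (f := fun N => ∑ σ, w N σ • permMat (ρ N σ)) (b := Filter.atTop)
    ?_ (Filter.Eventually.of_forall fun N => ?_)
  · refine tendsto_pi_nhds.2 fun m => tendsto_pi_nhds.2 fun k => tendsto_const_nhds.congr' ?_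
    filter_upwards [Filter.eventually_gt_atTop (max m k)] with N hN
    rw [← hcorner N m ((le_max_left _ _).trans_lt hN) k ((le_max_right _ _).trans_lt hN)]
    simp
  · exact (convex_convexHull ℝ _).sum_mem (fun σ _ => hw0 N σ) (hw1 N)
      fun σ _ => subset_convexHull ℝ _ ⟨ρ N σ, hρ N σ, rfl⟩

theorem isCompact_convexJoin {V : Type*} [AddCommGroup V] [Module ℝ V] [TopologicalSpace V]
    [ContinuousAdd V] [ContinuousSMul ℝ V] {s t : Set V} (hs : IsCompact s) (ht : IsCompact t) :
    IsCompact (convexJoin ℝ s t) := by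
  have h : convexJoin ℝ s t =
      (fun p : ℝ × V × V => (1 - p.1) • p.2.1 + p.1 • p.2.2) '' (Set.Icc 0 1 ×ˢ s ×ˢ t) := by
    ext v
    simp only [mem_convexJoin, segment_eq_image, Set.mem_image, Set.mem_prod, Prod.exists]
    constructor
    · rintro ⟨a, ha, b, hb, r, hr, rfl⟩
      exact ⟨r, a, b, ⟨hr, ha, hb⟩, rfl⟩
    · rintro ⟨r, a, b, ⟨hr, ha, hb⟩, rfl⟩
      exact ⟨a, ha, b, hb, r, hr, rfl⟩
  rw [h]
  exact (isCompact_Icc.prod (hs.prod ht)).image (by fun_prop)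

/-- A doubly substochastic matrix lies on a segment between doubly substochastic matrices whose
`(m, k)` entries are `1` and `0`. -/
theorem exists_segment_of_mem_substochastic {A : ℕ → ℕ → ℝ} (hA : A ∈ substochastic) (m k : ℕ) :
    ∃ X ∈ substochastic, ∃ Y ∈ substochastic, X m k = 1 ∧ Y m k = 0 ∧ A ∈ segment ℝ X Y := by
  have hlin : IsLinearMap ℝ fun X : ℕ → ℕ → ℝ => X m k := ⟨fun _ _ => rfl, fun _ _ => rfl⟩
  have hcont : Continuous fun X : ℕ → ℕ → ℝ => X m k := by fun_prop
  have hcomp : ∀ r : ℝ, IsCompact (substochastic ∩ {X | X m k = r}) := fun r =>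
    isCompact_substochastic.inter_right (isClosed_eq hcont continuous_const)
  have hconv : ∀ r : ℝ, Convex ℝ (substochastic ∩ {X | X m k = r}) := fun r =>
    convex_substochastic.inter (convex_hyperplane hlin r)
  have h1 : (substochastic ∩ {X | X m k = 1}).Nonempty :=
    -- The swap sends `k` to `m`, also when `m = k`.
    ⟨permMat (Equiv.swap m k), permMat_mem_substochastic _, by simp [permMat]⟩
  have h0 : (substochastic ∩ {X | X m k = 0}).Nonempty :=
    ⟨0, ⟨fun _ _ => le_rfl, fun _ _ => by simp, fun _ _ => by simp⟩, rfl⟩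
  have hsub : convexHull ℝ (permMat '' FS) ⊆
      convexJoin ℝ (substochastic ∩ {X | X m k = 1}) (substochastic ∩ {X | X m k = 0}) := by
    refine convexHull_min ?_ ((hconv 1).convexJoin (hconv 0))
    rintro _ ⟨ρ, -, rfl⟩
    by_cases h : ρ k = m
    · exact subset_convexJoin_left h0 ⟨permMat_mem_substochastic ρ, by simp [permMat, h]⟩
    · exact subset_convexJoin_right h1 ⟨permMat_mem_substochastic ρ, by simp [permMat, h]⟩
  have hmem := closure_minimal hsub (isCompact_convexJoin (hcomp 1) (hcomp 0)).isClosed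
    (substochastic_subset_closure hA)
  obtain ⟨X, ⟨hX, hX1⟩, Y, ⟨hY, hY0⟩, hseg⟩ := mem_convexJoin.1 hmem
  exact ⟨X, hX, Y, hY, hX1, hY0, hseg⟩

variable {H : Type*} [NormedAddCommGroup H] [InnerProductSpace ℂ H]

theorem eq_of_reMat_eq {e : HilbertBasis ℕ ℂ H} {a b : H →L[ℂ] H} (ha : a ∈ DSS e) (hb : b ∈ DSS e)
    (h : reMat e a = reMat e b) : a = b := by
  refine ContinuousLinearMap.ext_on (s := Set.range e)
    (Submodule.dense_iff_topologicalClosure_eq_top.2 e.dense_span) ?_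
  rintro _ ⟨k, rfl⟩
  apply e.repr.injective
  ext m
  rw [e.repr_apply_apply, e.repr_apply_apply]
  exact Complex.ext (congrFun (congrFun h m) k)
    (((mem_DSS_iff.1 ha).1 m k).trans ((mem_DSS_iff.1 hb).1 m k).symm)

theorem extremePoints_DSS_subset (e : HilbertBasis ℕ ℂ H) :
    Set.extremePoints ℝ (DSS e) ⊆ PS e := by
  intro a ha
  have haD : a ∈ DSS e := ha.1
  refine ⟨fun m k => ?_, haD.2⟩
  obtain ⟨X, hX, Y, hY, hX1, hY0, p, q, hp, hq, hpq, hA⟩ :=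
    exists_segment_of_mem_substochastic (mem_DSS_iff.1 haD).2 m k
  suffices h : reMat e a m k = 0 ∨ reMat e a m k = 1 by
    have him := (mem_DSS_iff.1 haD).1 m k
    exact h.imp (fun h => Complex.ext h him) fun h => Complex.ext h him
  have hmk : reMat e a m k = p := by
    rw [← hA]
    simp [hX1, hY0]
  rcases hp.eq_or_lt with rfl | hp
  · exact Or.inl hmk
  rcases hq.eq_or_lt with rfl | hq
  · exact Or.inr (by linarith)
  obtain ⟨x, hx, rfl⟩ := exists_mem_DSS_reMat_eq e hX
  obtain ⟨y, hy, rfl⟩ := exists_mem_DSS_reMat_eq e hY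
  have heq : p • x + q • y = a :=
    eq_of_reMat_eq (convex_DSS e hx hy hp.le hq.le hpq) haD
      (by rw [← hA, map_add, map_smul, map_smul])
  -- With both weights positive, extremality identifies `a` with `x`, whose entry is 1.
  have hxa : x = a := ha.2 hx hy ⟨p, q, hp, hq, hpq, heq⟩
  exact Or.inr (hxa ▸ hX1)

theorem PS_subset_extremePoints_DSS (e : HilbertBasis ℕ ℂ H) :
    PS e ⊆ Set.extremePoints ℝ (DSS e) := by
  intro a ha
  have haD : a ∈ DSS e := ⟨fun m k => by rcases ha.1 m k with h | h <;> simp [h], ha.2⟩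
  refine ⟨haD, fun x hx y hy => ?_⟩
  rintro ⟨p, q, hp, hq, hpq, rfl⟩
  refine eq_of_reMat_eq hx haD ?_
  ext m k
  have hX := (mem_DSS_iff.1 hx).2
  have hY := (mem_DSS_iff.1 hy).2
  have hX0 := hX.1 m k
  have hX1 := le_one_of_mem_substochastic hX m k
  have hY0 := hY.1 m k
  have hY1 := le_one_of_mem_substochastic hY m k
  have hval : reMat e (p • x + q • y) m k = p * reMat e x m k + q * reMat e y m k := by
    rw [map_add, map_smul, map_smul]
    rfl
  have h01 : reMat e (p • x + q • y) m k = 0 ∨ reMat e (p • x + q • y) m k = 1 :=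
    (ha.1 m k).imp (fun h => by rw [reMat_apply, h, Complex.zero_re])
      fun h => by rw [reMat_apply, h, Complex.one_re]
  -- An average with positive weights of numbers in [0, 1] equals 0 or 1 only if both numbers do.
  rcases h01 with h | h
  · rw [h] at hval ⊢
    nlinarith [mul_nonneg hp.le hX0, mul_nonneg hq.le hY0]
  · rw [h] at hval ⊢
    nlinarith [mul_nonneg hp.le (sub_nonneg.2 hX1), mul_nonneg hq.le (sub_nonneg.2 hY1)]

end Extreme

end PermHull

end

theorem mainTheorem1 {H : Type*} [NormedAddCommGroup H] [InnerProductSpace ℂ H] [CompleteSpace H]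
    (e : HilbertBasis ℕ ℂ H) :
    PermHull.closedHull (PermHull.arensMackey H) (PermHull.permOp e '' PermHull.FS) =
        PermHull.DSS e ∧
      PermHull.closedHull (PermHull.weakOperator H) (PermHull.permOp e '' PermHull.FS) =
        PermHull.DSS e ∧
      Set.extremePoints ℝ (PermHull.DSS e) = PermHull.PS e := by
  have h1 := PermHull.DSS_subset_closedHull_arensMackey e
  have h2 := PermHull.closedHull_arensMackey_subset (PermHull.permOp e '' PermHull.FS)
  have h3 := PermHull.closedHull_weakOperator_subset_DSS e
  exact ⟨(h2.trans h3).antisymm h1, h3.antisymm (h1.trans h2),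
    (PermHull.extremePoints_DSS_subset e).antisymm (PermHull.PS_subset_extremePoints_DSS e)⟩
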